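/- Let $E$ be a finite non-empty set, $X_+=E^{\mathbb Z_+}$, $X_-=E^{\{i\in\mathbb Z:\,i<0\}}$ and $X=E^{\mathbb Z}=X_-\times X_+$, with the product topologies and Borel $\sigma$-algebras; let $S$ denote the left shift on $X_+$ and on $X$, and let $S_n\phi=\sum_{k=0}^{n-1}\phi\circ S^k$. A specification on $E^{\mathbb L}$ ($\mathbb L$ countable) is a family $\gamma=(\gamma_\Lambda)$, indexed by the finite subsets $\Lambda$ of $\mathbb L$, of probability kernels $\gamma_\Lambda(\xi_\Lambda\,|\,\omega_{\Lambda^c})$, $(\gamma_\Lambda f)(\omega)=\sum_{\xi\in E^\Lambda}\gamma_\Lambda(\xi\,|\,\omega_{\Lambda^c})f(\xi\,\omega_{\Lambda^c})$, with $\gamma_\Lambda\gamma_\Delta=\gamma_\Lambda$ for $\Delta\subset\Lambda$. It is quasilocal if each $\omega\mapsto\gamma_\Lambda(\xi\,|\,\omega_{\Lambda^c})$ is continuous, and non-null if $\inf_{\xi,\omega}\gamma_\Lambda(\xi\,|\,\omega_{\Lambda^c})>0$ for every $\Lambda$. A probability measure $\mu$ is Gibbs for $\gamma$ if $\int\gamma_\Lambda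 f\,d\mu=\int f\,d\mu$ for all finite $\Lambda$ and all $f\in L^1(\mu)$. Let $\phi:X_+\to\mathbb R$ be a continuous function that satisfies the extensibility condition: for all $a,b\in E$ the functions $x\mapsto S_{n+1}\phi(x_{-n}^{-1}\,b\,x_1^\infty)-S_{n+1}\phi(x_{-n}^{-1}\,a\,x_1^\infty)$ converge uniformly on $X$ as $n\to\infty$. Let $\nu$ be a half-line Gibbs state for $\phi$, that is, a probability measure on $X_+$ that is Gibbs for the half-line specification $$\overset{\rightharpoonup}{\gamma}{}^{\phi}_\Lambda(a_\Lambda\,|\,x_{\Lambda^c})=\frac{\exp\big(S_{n+1}\phi(a_\Lambda x_{\Lambda^c})\big)}{\sum_{\bar a_\Lambda\in E^\Lambda}\exp\big(S_{n+1}\phi(\bar a_\Lambda x_{\Lambda^c})\big)},\qquad n=\max\Lambda .$$ Let $\rho$ be the uniform Bernoulli measure on $X_-$, $\mu_0=\rho\times\nu$ and $\mu_n=\mu_0\circ S^{-n}$. Suppose that $\mu_{n_k}$ converges in the weak$^*$ topology to a probability measure $\mu$ on $X$ for some strictly increasing sequence $(n_k)$. Then there is a unique translation-invariant, quasilocal,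 non-null specification $\overset{\rightleftharpoons}{\gamma}{}^{\phi}$ on $X$ with the single-site densities $$\overset{\rightleftharpoons}{\gamma}{}^{\phi}_{\{i\}}(\omega_i\,|\,\omega_{\{i\}^c})=\lim_{p\to\infty}\frac{\exp\big(S_{i+p+1}\phi(\omega_{-p}^{i-1}\,\omega_i\,\omega_{i+1}^\infty)\big)}{\sum_{b\in E}\exp\big(S_{i+p+1}\phi(\omega_{-p}^{i-1}\,b\,\omega_{i+1}^\infty)\big)},\qquad i\in\mathbb Z,\ \omega\in X,$$ where all these limits exist; for $\mu$-almost every $x$, $$\mu(x_0\,|\,x_{-\infty}^{-1},x_1^\infty)=\overset{\rightleftharpoons}{\gamma}{}^{\phi}_{\{0\}}(x_0\,|\,x_{-\infty}^{-1},x_1^\infty)=\lim_{n\to\infty}\frac{\exp\big(S_{n+1}\phi(x_{-n}^{-1}\,x_0\,x_1^\infty)\big)}{\sum_{b\in E}\exp\big(S_{n+1}\phi(x_{-n}^{-1}\,b\,x_1^\infty)\big)};$$ and $\mu$ is Gibbs for $\overset{\rightleftharpoons}{\gamma}{}^{\phi}$. -/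

import Mathlib

open MeasureTheory Filter Topology

noncomputable section

/-! ### Specifications on a lattice system `L → E` with finite `E`

A family of proper kernels `γ_Λ` is given by its densities: `γ Λ ω` stands for
`γ_Λ(ω_Λ | ω_{Λᶜ})`, so that `γ_Λ(ξ_Λ | η_{Λᶜ}) = γ Λ (ξ_Λ η_{Λᶜ})`, and the concatenation
`ξ_Λ η_{Λᶜ}` is `Function.updateFinset η Λ ξ`. -/

section Specification

variable {L E : Type*} [DecidableEq L] [Fintype E]

/-- The action of the kernel on functions:
`(γ_Λ f)(ω) = ∑_{ξ ∈ E^Λ} γ_Λ(ξ | ω_{Λᶜ}) f(ξ ω_{Λᶜ})`. -/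
def kernelAvg (γ : Finset L → (L → E) → ℝ) (Λ : Finset L) (f : (L → E) → ℝ) (ω : L → E) : ℝ :=
  ∑ ξ : Λ → E, γ Λ (Function.updateFinset ω Λ ξ) * f (Function.updateFinset ω Λ ξ)

/-- A specification: a consistent family of (proper) probability kernels. All sums are finite, so
consistency `γ_Λ γ_Δ = γ_Λ` can be tested on arbitrary functions. -/
structure IsSpecification [MeasurableSpace E] (γ : Finset L → (L → E) → ℝ) : Prop where
  measurable : ∀ Λ : Finset L, Measurable (γ Λ)
  nonneg : ∀ (Λ : Finset L) (ω : L → E), 0 ≤ γ Λ ω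
  sum_eq_one : ∀ (Λ : Finset L) (ω : L → E),
    ∑ ξ : Λ → E, γ Λ (Function.updateFinset ω Λ ξ) = 1
  consistent : ∀ Δ Λ : Finset L, Δ ⊆ Λ → ∀ f : (L → E) → ℝ,
    kernelAvg γ Λ (kernelAvg γ Δ f) = kernelAvg γ Λ f

/-- Quasilocality (for finite `E`): `η ↦ γ_Λ(ξ | η_{Λᶜ})` is continuous. -/
def IsQuasilocal [TopologicalSpace E] (γ : Finset L → (L → E) → ℝ) : Prop :=
  ∀ (Λ : Finset L) (ξ : Λ → E), Continuous fun η : L → E => γ Λ (Function.updateFinset η Λ ξ)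

/-- Non-nullness: every `γ_Λ` is bounded away from zero. -/
def IsNonNull (γ : Finset L → (L → E) → ℝ) : Prop :=
  ∀ Λ : Finset L, ∃ ε : ℝ, 0 < ε ∧ ∀ ω, ε ≤ γ Λ ω

/-- The probability measure `μ` is Gibbs for (consistent with) `γ`: the DLR equations
`∫ γ_Λ f dμ = ∫ f dμ` hold for all finite `Λ` and all `f ∈ L¹(μ)`. -/
def IsGibbs [MeasurableSpace E] (γ : Finset L → (L → E) → ℝ)
    (μ : ProbabilityMeasure (L → E)) : Prop :=
  ∀ (Λ : Finset L) (f : (L → E) → ℝ), Integrable f (μ : Measure (L → E)) →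
    Integrable (kernelAvg γ Λ f) (μ : Measure (L → E)) ∧
      ∫ ω, kernelAvg γ Λ f ω ∂(μ : Measure (L → E)) = ∫ ω, f ω ∂(μ : Measure (L → E))

end Specification

/-! ### The half-line -/

section HalfLine

variable {E : Type*}

/-- The left shift on `X₊ = E^{ℤ₊}`. -/
def halfShift (x : ℕ → E) : ℕ → E := fun i => x (i + 1)

/-- The half-line specification of the potential `φ`, with `n = max Λ`:
`γ_Λ(a_Λ | x_{Λᶜ}) = exp (S_{n+1} φ (a_Λ x_{Λᶜ})) / ∑_{ā_Λ} exp (S_{n+1} φ (ā_Λ x_{Λᶜ}))`. -/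
def halfLineSpec [Fintype E] (φ : (ℕ → E) → ℝ) (Λ : Finset ℕ) (x : ℕ → E) : ℝ :=
  Real.exp (birkhoffSum halfShift φ (Λ.sup id + 1) x) /
    ∑ ξ : Λ → E, Real.exp (birkhoffSum halfShift φ (Λ.sup id + 1) (Function.updateFinset x Λ ξ))

end HalfLine

/-! ### The whole line -/

section WholeLine

variable {E : Type*}

/-- The left shift on `X = E^ℤ`. -/
def shift (x : ℤ → E) : ℤ → E := fun i => x (i + 1)

/-- `x_{-n}^∞`, read as an element of `X₊`. -/
def tailFrom (n : ℕ) (x : ℤ → E) : ℕ → E := fun j => x ((j : ℤ) - (n : ℤ))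

/-- `F_n^{a,b}(x) = S_{n+1} φ (x_{-n}^{-1} b x_1^∞) - S_{n+1} φ (x_{-n}^{-1} a x_1^∞)`. -/
def flipDiff (φ : (ℕ → E) → ℝ) (a b : E) (n : ℕ) (x : ℤ → E) : ℝ :=
  birkhoffSum halfShift φ (n + 1) (tailFrom n (Function.update x 0 b)) -
    birkhoffSum halfShift φ (n + 1) (tailFrom n (Function.update x 0 a))

/-- The extensibility condition on a continuous potential. -/
def IsExtensible [TopologicalSpace E] (φ : (ℕ → E) → ℝ) : Prop :=
  Continuous φ ∧ ∀ a b : E, ∃ F : (ℤ → E) → ℝ, TendstoUniformly (flipDiff φ a b) F atTop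

/-- `exp (S_{i+p+1} φ (ω_{-p}^{i-1} ω_i ω_{i+1}^∞)) / ∑_b exp (S_{i+p+1} φ (ω_{-p}^{i-1} b ω_{i+1}^∞))`
(meaningful for `p ≥ -i`; only the limit `p → ∞` is used). -/
def singleSiteRatio [Fintype E] (φ : (ℕ → E) → ℝ) (i : ℤ) (p : ℕ) (ω : ℤ → E) : ℝ :=
  Real.exp (birkhoffSum halfShift φ (i + p + 1).toNat (tailFrom p ω)) /
    ∑ b : E, Real.exp
      (birkhoffSum halfShift φ (i + p + 1).toNat (tailFrom p (Function.update ω i b)))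

/-- Translation invariance: `γ_{Λ+k}(· | ω) = γ_Λ(S^k · | S^k ω)`. -/
def IsTranslationInvariant (γ : Finset ℤ → (ℤ → E) → ℝ) : Prop :=
  ∀ (Λ : Finset ℤ) (k : ℤ) (ω : ℤ → E),
    γ (Λ.image fun i => i + k) ω = γ Λ fun i => ω (i + k)

/-- `γ` is a whole-line specification of the potential `φ`: a translation-invariant, quasilocal,
non-null specification whose single-site densities are
`γ_{i}(ω_i | ω_{iᶜ}) = lim_{p → ∞} singleSiteRatio φ i p ω` (the limits being required to exist). -/
structure IsWholeLineSpec [Fintype E] [TopologicalSpace E] [MeasurableSpace E]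
    (φ : (ℕ → E) → ℝ) (γ : Finset ℤ → (ℤ → E) → ℝ) : Prop where
  isSpecification : IsSpecification γ
  translationInvariant : IsTranslationInvariant γ
  quasilocal : IsQuasilocal γ
  nonNull : IsNonNull γ
  singleSite : ∀ (i : ℤ) (ω : ℤ → E),
    Tendsto (fun p : ℕ => singleSiteRatio φ i p ω) atTop (𝓝 (γ {i} ω))

/-- Concatenation of a configuration on `{i < 0}` and one on `{i ≥ 0}`. -/
def glue (p : ({i : ℤ // i < 0} → E) × (ℕ → E)) : ℤ → E :=
  fun i => if h : i < 0 then p.1 ⟨i, h⟩ else p.2 i.toNat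

theorem measurable_glue [MeasurableSpace E] : Measurable (glue (E := E)) := by
  refine measurable_pi_lambda _ fun i => ?_
  by_cases h : i < 0
  · simp only [glue, h, dite_true]
    exact (measurable_pi_apply _).comp measurable_fst
  · simp only [glue, h, dite_false]
    exact (measurable_pi_apply _).comp measurable_snd

theorem measurable_shift [MeasurableSpace E] : Measurable (shift (E := E)) :=
  measurable_pi_lambda _ fun _ => measurable_pi_apply _

variable [Fintype E] [Nonempty E] [MeasurableSpace E] [MeasurableSingletonClass E]

/-- The uniform Bernoulli measure on `X₋ = E^{{i < 0}}`. -/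
def uniformBernoulli : ProbabilityMeasure ({i : ℤ // i < 0} → E) :=
  ⟨Measure.infinitePi fun _ => ProbabilityTheory.uniformOn (Set.univ : Set E), inferInstance⟩

/-- `μ₀ = ρ × ν` on `X = X₋ × X₊`, with `ρ` uniform Bernoulli. -/
def initialMeasure (ν : ProbabilityMeasure (ℕ → E)) : ProbabilityMeasure (ℤ → E) :=
  (uniformBernoulli.prod ν).map measurable_glue.aemeasurable

/-- `μ_n = μ₀ ∘ S^{-n}`, the image of `μ₀` under `S^n`. -/
def shiftedMeasure (ν : ProbabilityMeasure (ℕ → E)) (n : ℕ) : ProbabilityMeasure (ℤ → E) :=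
  (initialMeasure ν).map (measurable_shift.iterate n).aemeasurable

end WholeLine

end

/-!
The proof approximates the whole line by half-lines `[-p, ∞)`. For a finite `Λ ⊂ ℤ` let
`pastRatio φ N p Λ` be the Gibbs density in `Λ` with energy `S_N φ (x_{-p}^∞)`; it is the
half-line kernel in the volume `Λ + p`, seen from the site `-p`, and any `N > max Λ + p` gives the
same density.

A spin flip at the site `i` changes this energy by a flip difference of the configuration
translated by `i`, which converges uniformly as `p → ∞` by extensibility. Changing all of `Λ` is a
finite composition of flips, so the energy differences, and hence the densities, converge uniformly
(`IsExtensible.exists_tendstoUniformly_pastRatio`). The limit `wholeLineSpec φ` is continuous and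
positive, so non-null by compactness. Normalization, consistency and translation invariance hold
for the Gibbs kernels with a finite past and pass to the limit (`IsExtensible.isWholeLineSpec`).
Uniqueness is a general fact: consistency with the single-site kernels fixes the ratio
`γ_Λ(σ) / γ_Λ(σ')` for configurations related by a flip in `Λ`, and normalization does the rest
(`IsSpecification.eq_of_single_eq`).

Under `μ_p` the configuration read from the site `-p` on has law `ν`, so `μ_p` satisfies the DLR
equation of `pastRatio φ N p Λ` for functions of finitely many spins, once `p` is large. Since these
kernels converge uniformly to a continuous kernel, the equation survives in the weak limit `μ`
(`IsGibbs.integral_wholeLineSpec`). Indicators of cylinders determine the measure `μ γ_Λ`, so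
`μ γ_Λ = μ`, and `μ` is Gibbs (`IsSpecification.isGibbs_of_cylinders`). The formula for the
conditional probabilities is the DLR equation for the volume `{0}`, tested on the indicators of
`{x_0 = a} ∩ A` with `A` an event off the origin (`IsSpecification.condExp_eq`).
-/

/-! ### Gibbs kernels of a positive weight -/

section GibbsRatio

variable {L E : Type*} [DecidableEq L]

theorem updateFinset_updateFinset_self (ω : L → E) (Λ : Finset L) (ξ ζ : Λ → E) :
    Function.updateFinset (Function.updateFinset ω Λ ξ) Λ ζ = Function.updateFinset ω Λ ζ := by
  ext i
  by_cases h : i ∈ Λ <;> simp [Function.updateFinset, h]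

theorem updateFinset_eq_piecewise (ω η : L → E) (Λ : Finset L) :
    Function.updateFinset ω Λ (fun i => η i) = Λ.piecewise η ω := by
  ext i
  by_cases h : i ∈ Λ <;> simp [Function.updateFinset, h]

theorem updateFinset_self (ω : L → E) (Λ : Finset L) :
    Function.updateFinset ω Λ (fun i => ω i) = ω := by
  rw [updateFinset_eq_piecewise, Finset.piecewise_same]

theorem exists_updateFinset_eq_piecewise [Nonempty E] (Λ : Finset L) (ξ : Λ → E) :
    ∃ η : L → E, ∀ ω, Function.updateFinset ω Λ ξ = Λ.piecewise η ω := by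
  refine ⟨fun i => if h : i ∈ Λ then ξ ⟨i, h⟩ else Classical.arbitrary E, fun ω => ?_⟩
  ext i
  by_cases h : i ∈ Λ <;> simp [Function.updateFinset, h]

variable [Fintype E]

theorem sum_updateFinset_singleton (i : L) (ω : L → E) (g : (L → E) → ℝ) :
    ∑ ξ : ({i} : Finset L) → E, g (Function.updateFinset ω {i} ξ)
      = ∑ b : E, g (Function.update ω i b) := by
  refine Fintype.sum_equiv (Equiv.funUnique ({i} : Finset L) E) _ _ fun ξ => ?_
  rw [Function.updateFinset_singleton]
  rfl

/-- Fiber sums are compatible with the relabelling `ω ↦ ω ∘ e` of the sites. -/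
theorem sum_updateFinset_comp {L' : Type*} [DecidableEq L'] (e : L' → L)
    (he : Function.Injective e) (Λ : Finset L') (ω : L → E) (g : (L' → E) → ℝ) :
    ∑ ξ : ↥(Λ.image e) → E, g (fun j => Function.updateFinset ω (Λ.image e) ξ (e j))
      = ∑ ξ : Λ → E, g (Function.updateFinset (fun j => ω (e j)) Λ ξ) := by
  let ε : Λ ≃ (Λ.image e : Finset L) :=
    Equiv.ofBijective (fun j => ⟨e j, Finset.mem_image_of_mem e j.2⟩)
      ⟨fun a b h => Subtype.ext (he (congrArg Subtype.val h)), fun ⟨i, hi⟩ => by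
        obtain ⟨j, hj, rfl⟩ := Finset.mem_image.1 hi
        exact ⟨⟨j, hj⟩, rfl⟩⟩
  refine Fintype.sum_equiv (Equiv.arrowCongr ε.symm (Equiv.refl E)) _ _ fun ξ => ?_
  congr 1
  ext j
  by_cases h : j ∈ Λ
  · have h' : e j ∈ Λ.image e := Finset.mem_image_of_mem e h
    simp only [Function.updateFinset, h, h', dif_pos]
    rfl
  · have h' : e j ∉ Λ.image e := by
      rw [Finset.mem_image]
      rintro ⟨k, hk, hkj⟩
      exact h (he hkj ▸ hk)
    simp [Function.updateFinset, h, h']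

/-- Resampling `Δ ⊆ Λ` after `Λ` is exchangeable: under the uniform sum over both spins, the
configurations before and after the second resampling can be swapped. -/
theorem sum_sum_updateFinset_swap {Δ Λ : Finset L} (h : Δ ⊆ Λ) (ω : L → E)
    (g : (L → E) → (L → E) → ℝ) :
    ∑ ξ : Λ → E, ∑ ζ : Δ → E, g (Function.updateFinset ω Λ ξ)
        (Function.updateFinset (Function.updateFinset ω Λ ξ) Δ ζ)
      = ∑ ξ : Λ → E, ∑ ζ : Δ → E,
        g (Function.updateFinset (Function.updateFinset ω Λ ξ) Δ ζ)
          (Function.updateFinset ω Λ ξ) := by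
  rw [← Fintype.sum_prod_type', ← Fintype.sum_prod_type']
  let s : (Λ → E) × (Δ → E) → (Λ → E) × (Δ → E) := fun p =>
    (fun i => if hi : (i : L) ∈ Δ then p.2 ⟨i, hi⟩ else p.1 i, fun i => p.1 ⟨i, h i.2⟩)
  have hs : Function.Involutive s := by
    rintro ⟨ξ, ζ⟩
    refine Prod.ext ?_ ?_
    · ext i
      by_cases hi : (i : L) ∈ Δ <;> simp [s, hi]
    · ext i
      simp [s]
  have h1 : ∀ p, Function.updateFinset ω Λ (s p).1
      = Function.updateFinset (Function.updateFinset ω Λ p.1) Δ p.2 := by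
    intro p
    ext i
    by_cases hi : i ∈ Δ
    · simp [Function.updateFinset, s, hi, h hi]
    · by_cases hi' : i ∈ Λ <;> simp [Function.updateFinset, s, hi, hi']
  have h2 : ∀ p, Function.updateFinset (Function.updateFinset ω Λ (s p).1) Δ (s p).2
      = Function.updateFinset ω Λ p.1 := by
    intro p
    ext i
    by_cases hi : i ∈ Δ
    · simp [Function.updateFinset, s, hi, h hi]
    · by_cases hi' : i ∈ Λ <;> simp [Function.updateFinset, s, hi, hi']
  refine Fintype.sum_equiv hs.toPerm _ _ fun p => ?_
  change _ = g (Function.updateFinset (Function.updateFinset ω Λ (s p).1) Δ (s p).2)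
    (Function.updateFinset ω Λ (s p).1)
  rw [h1 p, ← h1 p, h2 p]

/-- The density of the kernel that resamples the spins in `Λ` proportionally to the weight `w`. -/
noncomputable def gibbsRatio (w : (L → E) → ℝ) (Λ : Finset L) (ω : L → E) : ℝ :=
  w ω / ∑ ξ : Λ → E, w (Function.updateFinset ω Λ ξ)

variable {w : (L → E) → ℝ}

theorem sum_weight_pos (hw : ∀ ω, 0 < w ω) (Λ : Finset L) (ω : L → E) :
    0 < ∑ ξ : Λ → E, w (Function.updateFinset ω Λ ξ) :=
  Finset.sum_pos (fun _ _ => hw _) ⟨fun i => ω i, Finset.mem_univ _⟩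

theorem gibbsRatio_updateFinset (Λ : Finset L) (ω : L → E) (ξ : Λ → E) :
    gibbsRatio w Λ (Function.updateFinset ω Λ ξ) =
      w (Function.updateFinset ω Λ ξ) / ∑ ζ : Λ → E, w (Function.updateFinset ω Λ ζ) := by
  simp only [gibbsRatio, updateFinset_updateFinset_self]

theorem gibbsRatio_sum_eq_one (hw : ∀ ω, 0 < w ω) (Λ : Finset L) (ω : L → E) :
    ∑ ξ : Λ → E, gibbsRatio w Λ (Function.updateFinset ω Λ ξ) = 1 := by
  simp only [gibbsRatio_updateFinset]
  rw [← Finset.sum_div, div_self (sum_weight_pos hw Λ ω).ne']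

theorem gibbsRatio_consistent (hw : ∀ ω, 0 < w ω) {Δ Λ : Finset L} (h : Δ ⊆ Λ)
    (f : (L → E) → ℝ) :
    kernelAvg (gibbsRatio w) Λ (kernelAvg (gibbsRatio w) Δ f)
      = kernelAvg (gibbsRatio w) Λ f := by
  ext ω
  simp only [kernelAvg, gibbsRatio_updateFinset]
  simp only [div_mul_eq_mul_div, ← Finset.sum_div]
  congr 1
  simp only [Finset.mul_sum, Finset.sum_div, mul_div_assoc]
  -- exchange the two configurations, so that the inner sum becomes the normalization over `Δ`
  have key := sum_sum_updateFinset_swap h ω fun x y =>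
    w x * (w y * (f y / ∑ ζ : Δ → E, w (Function.updateFinset y Δ ζ)))
  simp only [updateFinset_updateFinset_self] at key
  rw [key]
  refine Finset.sum_congr rfl fun ξ _ => ?_
  rw [← Finset.sum_mul]
  field_simp [(sum_weight_pos hw Δ (Function.updateFinset ω Λ ξ)).ne']

theorem gibbsRatio_comp {L' : Type*} [DecidableEq L'] (e : L' → L)
    (he : Function.Injective e) (w' : (L' → E) → ℝ) (Λ : Finset L') (ω : L → E) :
    gibbsRatio (fun x => w' fun j => x (e j)) (Λ.image e) ω
      = gibbsRatio w' Λ fun j => ω (e j) := by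
  simp only [gibbsRatio]
  rw [sum_updateFinset_comp e he Λ ω w']

end GibbsRatio

/-! ### Uniqueness of a positive specification with given single-site densities -/

section Uniqueness

variable {L E : Type*} [DecidableEq L] [Fintype E] [MeasurableSpace E]
  {γ γ' : Finset L → (L → E) → ℝ}

/-- Consistency of `γ_Λ` with a single-site kernel, tested on the indicator of a point. -/
theorem IsSpecification.eq_single_mul_sum (hγ : IsSpecification γ) {Λ : Finset L} {i : L}
    (hi : i ∈ Λ) (σ : L → E) :
    γ Λ σ = γ {i} σ * ∑ b : E, γ Λ (Function.update σ i b) := by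
  classical
  let f : (L → E) → ℝ := fun x => if x = σ then 1 else 0
  have hc := congrFun (hγ.consistent {i} Λ (Finset.singleton_subset_iff.2 hi) f) σ
  have h := sum_sum_updateFinset_swap (Finset.singleton_subset_iff.2 hi) σ
    fun x y => γ Λ x * (γ {i} y * f y)
  have hξ : ∀ ξ : Λ → E, Function.updateFinset σ Λ ξ = σ ↔ ξ = fun j : Λ => σ j := by
    refine fun ξ => ⟨fun hx => ?_, fun hx => hx ▸ updateFinset_self σ Λ⟩
    ext j
    simpa [Function.updateFinset] using congrFun hx j
  simp only [kernelAvg, Finset.mul_sum] at hc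
  rw [h] at hc
  simp only [f, hξ, mul_ite, mul_one, mul_zero, Finset.sum_ite_irrel, Finset.sum_const_zero,
    Finset.sum_ite_eq', Finset.mem_univ, if_true, updateFinset_self] at hc
  rw [sum_updateFinset_singleton i σ (fun x => γ Λ x * γ {i} σ), ← Finset.sum_mul] at hc
  rw [← hc, mul_comm]

/-- The kernels of a positive specification are determined by its single-site kernels: the ratio
of two candidates for `γ_Λ` is invariant under each spin flip in `Λ`, and both are normalized. -/
theorem IsSpecification.eq_of_single_eq (hγ : IsSpecification γ) (hγ' : IsSpecification γ')
    (hpos : ∀ Λ ω, 0 < γ Λ ω) (h : ∀ i, γ {i} = γ' {i}) : γ = γ' := by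
  have hflip : ∀ (Λ : Finset L) (i : L), i ∈ Λ → ∀ (σ : L → E) (b : E),
      γ' Λ (Function.update σ i b) / γ Λ (Function.update σ i b) = γ' Λ σ / γ Λ σ := by
    intro Λ i hi σ b
    have hp := hpos {i} (Function.update σ i b)
    have hp' := hpos {i} σ
    have h1 := hγ.eq_single_mul_sum hi σ
    have h2 := hγ.eq_single_mul_sum hi (Function.update σ i b)
    have h3 := hγ'.eq_single_mul_sum hi σ
    have h4 := hγ'.eq_single_mul_sum hi (Function.update σ i b)
    simp only [Function.update_idem, ← h] at h1 h2 h3 h4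
    rw [h2, h4, h1, h3, mul_div_mul_left _ _ hp.ne', mul_div_mul_left _ _ hp'.ne']
  have hpw : ∀ (Λ : Finset L) (η σ : L → E) (Δ : Finset L), Δ ⊆ Λ →
      γ' Λ (Δ.piecewise η σ) / γ Λ (Δ.piecewise η σ) = γ' Λ σ / γ Λ σ := by
    intro Λ η σ Δ
    induction Δ using Finset.induction_on with
    | empty => simp
    | insert i Δ _ ih =>
      intro hs
      rw [Finset.piecewise_insert, hflip Λ i (hs (Finset.mem_insert_self _ _)),
        ih ((Finset.subset_insert _ _).trans hs)]
  ext Λ σ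
  have hsum := hγ'.sum_eq_one Λ σ
  have hsum' := hγ.sum_eq_one Λ σ
  have hmul : ∀ ξ : Λ → E, γ' Λ (Function.updateFinset σ Λ ξ)
      = γ' Λ σ / γ Λ σ * γ Λ (Function.updateFinset σ Λ ξ) := by
    intro ξ
    have hη : Function.updateFinset σ Λ ξ
        = Λ.piecewise (Function.updateFinset σ Λ ξ) σ := by
      ext i
      by_cases hi : i ∈ Λ <;> simp [Function.updateFinset, hi]
    rw [← div_eq_iff (hpos _ _).ne']
    have := hpw Λ (Function.updateFinset σ Λ ξ) σ Λ subset_rfl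
    rwa [← hη] at this
  simp only [hmul, ← Finset.mul_sum, hsum', mul_one] at hsum
  exact ((div_eq_one_iff_eq (hpos _ _).ne').1 hsum).symm

end Uniqueness

/-! ### Energies read from a finite past -/

section PastEnergy

variable {E : Type*}

theorem iterate_halfShift (k : ℕ) (x : ℕ → E) : halfShift^[k] x = fun j => x (j + k) := by
  induction k with
  | zero => rfl
  | succ k ih =>
    rw [Function.iterate_succ_apply', ih]
    ext j
    simp only [halfShift]
    congr 1
    omega

/-- The Birkhoff sum `S_N φ (x_{-p}^∞)`, as a function on the whole line. -/
noncomputable def pastEnergy (φ : (ℕ → E) → ℝ) (N p : ℕ) (x : ℤ → E) : ℝ :=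
  birkhoffSum halfShift φ N (tailFrom p x)

/-- Changing a configuration inside `{i : i + p < N}` changes the energies `S_N φ` and `S_{N'} φ`
by the same amount, for any `N' ≥ N`: the additional terms do not see the change. -/
theorem pastEnergy_sub_eq_of_le (φ : (ℕ → E) → ℝ) {N N' p : ℕ} (hN : N ≤ N') {x y : ℤ → E}
    (h : ∀ i : ℤ, (N : ℤ) ≤ i + p → x i = y i) :
    pastEnergy φ N' p x - pastEnergy φ N' p y = pastEnergy φ N p x - pastEnergy φ N p y := by
  obtain ⟨d, rfl⟩ := Nat.exists_eq_add_of_le hN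
  have hxy : halfShift^[N] (tailFrom p x) = halfShift^[N] (tailFrom p y) := by
    rw [iterate_halfShift, iterate_halfShift]
    ext j
    refine h _ ?_
    push_cast
    omega
  simp only [pastEnergy, birkhoffSum_add, hxy]
  ring

theorem pastEnergy_sub_eq (φ : (ℕ → E) → ℝ) {N N' p : ℕ} {x y : ℤ → E}
    (h : ∀ i : ℤ, (N : ℤ) ≤ i + p → x i = y i) (h' : ∀ i : ℤ, (N' : ℤ) ≤ i + p → x i = y i) :
    pastEnergy φ N' p x - pastEnergy φ N' p y = pastEnergy φ N p x - pastEnergy φ N p y := by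
  rcases le_total N N' with hN | hN
  · exact pastEnergy_sub_eq_of_le φ hN h
  · exact (pastEnergy_sub_eq_of_le φ hN h').symm

/-- A single flip at `i` is a flip at the origin of the translated configuration. -/
theorem pastEnergy_update_sub (φ : (ℕ → E) → ℝ) {N p : ℕ} {i : ℤ} (hp : 0 ≤ i + p)
    (hN : i + p < N) (x : ℤ → E) (b : E) :
    pastEnergy φ N p (Function.update x i b) - pastEnergy φ N p x
      = flipDiff φ (x i) b (i + p).toNat fun j => x (j + i) := by
  have ht : ∀ c : E, tailFrom (i + p).toNat (Function.update (fun j => x (j + i)) 0 c)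
      = tailFrom p (Function.update x i c) := by
    intro c
    ext j
    simp only [tailFrom, Int.toNat_of_nonneg hp, Function.update_apply]
    have : ((j : ℤ) - (i + p) = 0) ↔ ((j : ℤ) - p = i) := by omega
    simp only [this]
    split_ifs
    · rfl
    · congr 1
      ring
  have hsub := pastEnergy_sub_eq φ (N := (i + p).toNat + 1) (N' := N) (p := p)
    (x := Function.update x i b) (y := x)
    (fun j hj => Function.update_of_ne (by omega) _ _)
    (fun j hj => Function.update_of_ne (by omega) _ _)
  rw [hsub, flipDiff, ht, ht, Function.update_eq_self]
  rfl

theorem continuous_pastEnergy [TopologicalSpace E] {φ : (ℕ → E) → ℝ} (hφ : Continuous φ)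
    (N p : ℕ) : Continuous (pastEnergy φ N p) := by
  unfold pastEnergy birkhoffSum
  refine continuous_finsetSum _ fun k _ => hφ.comp ?_
  simp only [iterate_halfShift]
  exact continuous_pi fun j => continuous_apply _

theorem continuous_updateFinset_left [TopologicalSpace E] (Λ : Finset ℤ) (ξ : Λ → E) :
    Continuous fun x : ℤ → E => Function.updateFinset x Λ ξ := by
  refine continuous_pi fun i => ?_
  by_cases h : i ∈ Λ
  · simpa [Function.updateFinset, h] using continuous_const
  · simpa [Function.updateFinset, h] using continuous_apply i

end PastEnergy

/-! ### Uniform convergence of the energy differences -/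

section Convergence

variable {E : Type*} [Finite E] [TopologicalSpace E] {φ : (ℕ → E) → ℝ}

theorem tendsto_toNat_add (i : ℤ) : Tendsto (fun p : ℕ => (i + p).toNat) atTop atTop := by
  refine tendsto_atTop_atTop.2 fun b => ⟨b + i.natAbs, fun p hp => ?_⟩
  omega

theorem IsExtensible.exists_tendstoUniformly_update (hφ : IsExtensible φ) (i : ℤ) (b : E) :
    ∃ D : (ℤ → E) → ℝ, ∀ N : ℕ → ℕ, (∀ᶠ p : ℕ in atTop, i + p < N p) →
      TendstoUniformly (fun p x => pastEnergy φ (N p) p (Function.update x i b)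
        - pastEnergy φ (N p) p x) D atTop := by
  choose F hF using fun a => hφ.2 a b
  refine ⟨fun x => F (x i) fun j => x (j + i), fun N hN => ?_⟩
  rw [Metric.tendstoUniformly_iff]
  intro ε hε
  have h1 : ∀ᶠ q : ℕ in atTop, ∀ a x, dist (F a x) (flipDiff φ a b q x) < ε :=
    eventually_all.2 fun a => Metric.tendstoUniformly_iff.1 (hF a) ε hε
  filter_upwards [hN, (tendsto_toNat_add i).eventually h1, eventually_ge_atTop i.natAbs]
    with p hp hq hpi x
  rw [pastEnergy_update_sub φ (by omega) hp]
  exact hq _ _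

theorem IsExtensible.exists_tendstoUniformly_piecewise (hφ : IsExtensible φ) (Λ : Finset ℤ)
    (η : ℤ → E) :
    ∃ D : (ℤ → E) → ℝ, ∀ N : ℕ → ℕ, (∀ᶠ p : ℕ in atTop, ∀ i ∈ Λ, i + p < N p) →
      TendstoUniformly (fun p x => pastEnergy φ (N p) p (Λ.piecewise η x)
        - pastEnergy φ (N p) p x) D atTop := by
  induction Λ using Finset.induction_on with
  | empty =>
    refine ⟨fun _ => 0, fun N _ => ?_⟩
    simp only [Finset.piecewise_empty, sub_self]
    exact Metric.tendstoUniformly_iff.2 fun ε hε => by simp [hε]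
  | insert i Λ _ ih =>
    obtain ⟨D₁, h₁⟩ := ih
    obtain ⟨D₂, h₂⟩ := hφ.exists_tendstoUniformly_update i (η i)
    refine ⟨fun x => D₂ (Λ.piecewise η x) + D₁ x, fun N hN => ?_⟩
    have h := ((h₂ N (hN.mono fun p hp => hp i (Finset.mem_insert_self _ _))).comp
      fun x => Λ.piecewise η x).add
        (h₁ N (hN.mono fun p hp j hj => hp j (Finset.mem_insert_of_mem hj)))
    refine (tendstoUniformly_congr (Eventually.of_forall fun p => ?_)).1 h
    ext x
    simp [Finset.piecewise_insert]

end Convergence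

/-! ### The limiting densities -/

section Limit

variable {E : Type*} [Fintype E]

/-- The density of the Gibbs kernel in `Λ` with energy `S_N φ (x_{-p}^∞)`. It does not depend on
`N` as soon as `N > max Λ + p`. -/
noncomputable def pastRatio (φ : (ℕ → E) → ℝ) (N p : ℕ) (Λ : Finset ℤ) (x : ℤ → E) : ℝ :=
  gibbsRatio (fun y => Real.exp (pastEnergy φ N p y)) Λ x

theorem pastRatio_eq_inv (φ : (ℕ → E) → ℝ) (N p : ℕ) (Λ : Finset ℤ) (x : ℤ → E) :
    pastRatio φ N p Λ x = (∑ ξ : Λ → E, Real.exp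
      (pastEnergy φ N p (Function.updateFinset x Λ ξ) - pastEnergy φ N p x))⁻¹ := by
  simp only [pastRatio, gibbsRatio, Real.exp_sub, ← Finset.sum_div, inv_div]

theorem singleSiteRatio_eq_pastRatio (φ : (ℕ → E) → ℝ) (i : ℤ) (p : ℕ) (x : ℤ → E) :
    singleSiteRatio φ i p x = pastRatio φ (i + p + 1).toNat p {i} x := by
  rw [pastRatio, gibbsRatio, sum_updateFinset_singleton i x
    fun y => Real.exp (pastEnergy φ (i + p + 1).toNat p y)]
  rfl

/-- Translating by `k` amounts to reading the past from `k` sites further to the left. -/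
theorem pastRatio_image_add (φ : (ℕ → E) → ℝ) (N p : ℕ) {k : ℤ} (hk : 0 ≤ k + p)
    (Λ : Finset ℤ) (x : ℤ → E) :
    pastRatio φ N p (Λ.image fun i => i + k) x
      = pastRatio φ N (k + p).toNat Λ fun i => x (i + k) := by
  rw [pastRatio, pastRatio, ← gibbsRatio_comp (fun i => i + k) (add_left_injective k)]
  congr 1
  ext y
  simp only [pastEnergy]
  congr 2
  ext j
  simp only [tailFrom, Int.toNat_of_nonneg hk]
  congr 1
  ring

/-- A whole-line specification of `φ` is unique. -/
theorem IsWholeLineSpec.eq [TopologicalSpace E] [MeasurableSpace E] {φ : (ℕ → E) → ℝ}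
    {γ γ' : Finset ℤ → (ℤ → E) → ℝ}
    (hγ : IsWholeLineSpec φ γ) (hγ' : IsWholeLineSpec φ γ') : γ = γ' := by
  refine hγ.isSpecification.eq_of_single_eq hγ'.isSpecification (fun Λ ω => ?_) fun i => ?_
  · obtain ⟨ε, hε, h⟩ := hγ.nonNull Λ
    exact hε.trans_le (h ω)
  · ext ω
    exact tendsto_nhds_unique (hγ.singleSite i ω) (hγ'.singleSite i ω)

variable [TopologicalSpace E] {φ : (ℕ → E) → ℝ}

/-- The finite-past densities converge uniformly, to a continuous and positive limit. -/
theorem IsExtensible.exists_tendstoUniformly_pastRatio [Nonempty E] (hφ : IsExtensible φ)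
    (Λ : Finset ℤ) :
    ∃ G : (ℤ → E) → ℝ, Continuous G ∧ (∀ x, 0 < G x) ∧
      ∀ N : ℕ → ℕ, (∀ᶠ p : ℕ in atTop, ∀ i ∈ Λ, i + p < N p) →
        TendstoUniformly (fun p => pastRatio φ (N p) p Λ) G atTop := by
  have hD : ∀ ξ : Λ → E, ∃ D : (ℤ → E) → ℝ, ∀ N : ℕ → ℕ,
      (∀ᶠ p : ℕ in atTop, ∀ i ∈ Λ, i + p < N p) →
      TendstoUniformly (fun p x => pastEnergy φ (N p) p (Function.updateFinset x Λ ξ)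
        - pastEnergy φ (N p) p x) D atTop := by
    intro ξ
    obtain ⟨η, hη⟩ := exists_updateFinset_eq_piecewise Λ ξ
    obtain ⟨D, h⟩ := hφ.exists_tendstoUniformly_piecewise Λ η
    exact ⟨D, fun N hN => by simpa only [hη] using h N hN⟩
  choose D hD using hD
  have hcp : ∀ (ξ : Λ → E) (N p : ℕ), Continuous fun x : ℤ → E =>
      pastEnergy φ N p (Function.updateFinset x Λ ξ) - pastEnergy φ N p x := fun ξ N p =>
    ((continuous_pastEnergy hφ.1 N p).comp (continuous_updateFinset_left Λ ξ)).sub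
      (continuous_pastEnergy hφ.1 N p)
  have hcD : ∀ ξ, Continuous (D ξ) := by
    intro ξ
    refine (hD ξ (fun p => Λ.sup Int.natAbs + p + 1)
      (Eventually.of_forall fun p i hi => ?_)).continuous
      (Eventually.of_forall fun p => hcp ξ _ p).frequently
    have := Finset.le_sup (f := Int.natAbs) hi
    push_cast
    omega
  have hs : ∀ v : (Λ → E) → ℝ, 0 < ∑ ξ, Real.exp (v ξ) := fun v =>
    Finset.sum_pos (fun _ _ => Real.exp_pos _) Finset.univ_nonempty
  refine ⟨fun x => (∑ ξ, Real.exp (D ξ x))⁻¹, ?_, fun x => inv_pos.2 (hs _), fun N hN => ?_⟩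
  · exact (continuous_finsetSum _ fun ξ _ => Real.continuous_exp.comp (hcD ξ)).inv₀
      fun x => (hs _).ne'
  -- On the compact space `E^ℤ`, uniform convergence is convergence in `C(E^ℤ, ·)`, where
  -- composition with the continuous map `v ↦ (∑ exp v)⁻¹` is continuous.
  let g : C((Λ → E) → ℝ, ℝ) := ⟨fun v => (∑ ξ, Real.exp (v ξ))⁻¹,
    (continuous_finsetSum _ fun ξ _ => Real.continuous_exp.comp (continuous_apply ξ)).inv₀
      fun v => (hs v).ne'⟩
  let d : ℕ → C(ℤ → E, (Λ → E) → ℝ) := fun p => ⟨fun x ξ =>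
    pastEnergy φ (N p) p (Function.updateFinset x Λ ξ) - pastEnergy φ (N p) p x,
    continuous_pi fun ξ => hcp ξ _ p⟩
  let d' : C(ℤ → E, (Λ → E) → ℝ) := ⟨fun x ξ => D ξ x, continuous_pi hcD⟩
  have hd : Tendsto d atTop (𝓝 d') := by
    rw [ContinuousMap.tendsto_iff_tendstoUniformly, Metric.tendstoUniformly_iff]
    intro ε hε
    have h1 : ∀ᶠ p in atTop, ∀ ξ x, dist (D ξ x) (d p x ξ) < ε :=
      eventually_all.2 fun ξ => Metric.tendstoUniformly_iff.1 (hD ξ N hN) ε hε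
    filter_upwards [h1] with p hp x
    exact (dist_pi_lt_iff hε).2 fun ξ => hp ξ x
  have h := ((ContinuousMap.continuous_postcomp g).tendsto d').comp hd
  rw [ContinuousMap.tendsto_iff_tendstoUniformly] at h
  refine (tendstoUniformly_congr (Eventually.of_forall fun p => ?_)).1 h
  ext x
  exact (pastRatio_eq_inv φ (N p) p Λ x).symm

/-- The whole-line densities `γ_Λ`: the limits of the Gibbs densities with energy
`S_N φ (x_{-p}^∞)` as `p → ∞`. The value `N = max_{i ∈ Λ} |i| + p + 1` is one admissible choice. -/
noncomputable def wholeLineSpec (φ : (ℕ → E) → ℝ) (Λ : Finset ℤ) (x : ℤ → E) : ℝ :=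
  limUnder atTop fun p : ℕ => pastRatio φ (Λ.sup Int.natAbs + p + 1) p Λ x

theorem add_lt_sup_natAbs {Λ : Finset ℤ} {i : ℤ} (hi : i ∈ Λ) (p : ℕ) :
    i + p < ((Λ.sup Int.natAbs + p + 1 : ℕ) : ℤ) := by
  have := Finset.le_sup (f := Int.natAbs) hi
  push_cast
  omega

theorem IsExtensible.wholeLineSpec_spec [Nonempty E] (hφ : IsExtensible φ) (Λ : Finset ℤ) :
    Continuous (wholeLineSpec φ Λ) ∧ (∀ x, 0 < wholeLineSpec φ Λ x) ∧
      ∀ N : ℕ → ℕ, (∀ᶠ p : ℕ in atTop, ∀ i ∈ Λ, i + p < N p) →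
        TendstoUniformly (fun p => pastRatio φ (N p) p Λ) (wholeLineSpec φ Λ) atTop := by
  obtain ⟨G, hG⟩ := hφ.exists_tendstoUniformly_pastRatio Λ
  have : wholeLineSpec φ Λ = G := by
    ext x
    exact ((hG.2.2 (fun p => Λ.sup Int.natAbs + p + 1)
      (Eventually.of_forall fun p i hi => add_lt_sup_natAbs hi p)).tendsto_at x).limUnder_eq
  rwa [this]

theorem IsExtensible.continuous_wholeLineSpec [Nonempty E] (hφ : IsExtensible φ)
    (Λ : Finset ℤ) : Continuous (wholeLineSpec φ Λ) :=
  (hφ.wholeLineSpec_spec Λ).1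

theorem IsExtensible.wholeLineSpec_pos [Nonempty E] (hφ : IsExtensible φ)
    (Λ : Finset ℤ) (x : ℤ → E) : 0 < wholeLineSpec φ Λ x :=
  (hφ.wholeLineSpec_spec Λ).2.1 x

theorem IsExtensible.tendstoUniformly_pastRatio [Nonempty E] (hφ : IsExtensible φ)
    {Λ : Finset ℤ} {N : ℕ → ℕ} (hN : ∀ᶠ p : ℕ in atTop, ∀ i ∈ Λ, i + p < N p) :
    TendstoUniformly (fun p => pastRatio φ (N p) p Λ) (wholeLineSpec φ Λ) atTop :=
  (hφ.wholeLineSpec_spec Λ).2.2 N hN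

/-- The finite-past kernels converge pointwise, also along a convergent sequence of functions; this
covers the iterated kernels in the consistency equation. -/
theorem IsExtensible.tendsto_kernelAvg [Nonempty E] (hφ : IsExtensible φ)
    {Λ : Finset ℤ} {N : ℕ → ℕ} (hN : ∀ᶠ p : ℕ in atTop, ∀ i ∈ Λ, i + p < N p)
    {f : ℕ → (ℤ → E) → ℝ} {g : (ℤ → E) → ℝ} (hf : ∀ x, Tendsto (fun p => f p x) atTop (𝓝 (g x)))
    (x : ℤ → E) :
    Tendsto (fun p => kernelAvg (pastRatio φ (N p) p) Λ (f p) x) atTop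
      (𝓝 (kernelAvg (wholeLineSpec φ) Λ g x)) :=
  tendsto_finsetSum _ fun _ _ => ((hφ.tendstoUniformly_pastRatio hN).tendsto_at _).mul (hf _)

/-- The limiting densities form a whole-line specification: each property passes to the limit
from the Gibbs kernels with a finite past. -/
theorem IsExtensible.isWholeLineSpec [Nonempty E] [MeasurableSpace E] [BorelSpace E]
    (hφ : IsExtensible φ) : IsWholeLineSpec φ (wholeLineSpec φ) where
  isSpecification :=
    { measurable := fun Λ => (hφ.continuous_wholeLineSpec Λ).measurable
      nonneg := fun Λ x => (hφ.wholeLineSpec_pos Λ x).le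
      sum_eq_one := by
        intro Λ x
        have h : Tendsto (fun p : ℕ => ∑ ξ : Λ → E, pastRatio φ (Λ.sup Int.natAbs + p + 1) p Λ
            (Function.updateFinset x Λ ξ)) atTop
            (𝓝 (∑ ξ : Λ → E, wholeLineSpec φ Λ (Function.updateFinset x Λ ξ))) :=
          tendsto_finsetSum _ fun ξ _ => (hφ.tendstoUniformly_pastRatio
            (Eventually.of_forall fun p i hi => add_lt_sup_natAbs hi p)).tendsto_at _
        simp only [pastRatio, gibbsRatio_sum_eq_one fun _ => Real.exp_pos _] at h
        exact tendsto_nhds_unique h tendsto_const_nhds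
      consistent := by
        intro Δ Λ hΔ f
        ext x
        have hΛN : ∀ᶠ p : ℕ in atTop, ∀ i ∈ Λ, i + p < ((Λ.sup Int.natAbs + p + 1 : ℕ) : ℤ) :=
          Eventually.of_forall fun p i hi => add_lt_sup_natAbs hi p
        have hΔN : ∀ᶠ p : ℕ in atTop, ∀ i ∈ Δ, i + p < ((Λ.sup Int.natAbs + p + 1 : ℕ) : ℤ) :=
          hΛN.mono fun p hp i hi => hp i (hΔ hi)
        have h := hφ.tendsto_kernelAvg hΛN
          (hφ.tendsto_kernelAvg hΔN fun y => tendsto_const_nhds (x := f y)) x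
        have h' := hφ.tendsto_kernelAvg hΛN (fun y => tendsto_const_nhds (x := f y)) x
        refine tendsto_nhds_unique h (h'.congr fun p => ?_)
        exact (congrFun (gibbsRatio_consistent (fun _ => Real.exp_pos _) hΔ f) x).symm }
  translationInvariant := by
    intro Λ k x
    let N : ℕ → ℕ := fun p => Λ.sup Int.natAbs + (k + p).toNat + 1
    have h1 := (hφ.tendstoUniformly_pastRatio (Λ := Λ.image fun i => i + k) (N := N) (by
      filter_upwards [eventually_ge_atTop k.natAbs] with p hp i hi
      obtain ⟨j, hj, rfl⟩ := Finset.mem_image.1 hi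
      have := add_lt_sup_natAbs hj (k + p).toNat
      change _ < ((Λ.sup Int.natAbs + (k + p).toNat + 1 : ℕ) : ℤ)
      omega)).tendsto_at x
    have h2 := ((hφ.tendstoUniformly_pastRatio (Λ := Λ) (Eventually.of_forall fun p i hi =>
      add_lt_sup_natAbs hi p)).tendsto_at fun i => x (i + k)).comp (tendsto_toNat_add k)
    refine tendsto_nhds_unique h1 (h2.congr' ?_)
    filter_upwards [eventually_ge_atTop k.natAbs] with p hp
    exact (pastRatio_image_add φ (N p) p (by omega) Λ x).symm
  quasilocal := fun Λ ξ =>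
    (hφ.continuous_wholeLineSpec Λ).comp (continuous_updateFinset_left Λ ξ)
  nonNull := by
    intro Λ
    obtain ⟨x, -, hx⟩ := isCompact_univ.exists_isMinOn (Set.univ_nonempty (α := ℤ → E))
      (hφ.continuous_wholeLineSpec Λ).continuousOn
    exact ⟨_, hφ.wholeLineSpec_pos Λ x, fun y => hx (Set.mem_univ y)⟩
  singleSite := by
    intro i x
    simp only [singleSiteRatio_eq_pastRatio]
    refine (hφ.tendstoUniformly_pastRatio (Λ := {i}) (N := fun p => (i + p + 1).toNat)
      (Eventually.of_forall fun p j hj => ?_)).tendsto_at x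
    rw [Finset.mem_singleton.1 hj]
    omega

end Limit

/-! ### Extending the DLR equations from cylinders to integrable functions -/

section DLRExtension

variable {L E : Type*} [DecidableEq L] [MeasurableSpace E]

theorem measurable_updateFinset_config (Λ : Finset L) (ξ : Λ → E) :
    Measurable fun x : L → E => Function.updateFinset x Λ ξ := by
  refine measurable_pi_lambda _ fun i => ?_
  by_cases h : i ∈ Λ
  · simp [Function.updateFinset, h]
  · simpa [Function.updateFinset, h] using measurable_pi_apply i

variable [Fintype E] {γ : Finset L → (L → E) → ℝ}

theorem IsSpecification.measurable_kernelAvg (hγ : IsSpecification γ) (Λ : Finset L)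
    {f : (L → E) → ℝ} (hf : Measurable f) : Measurable (kernelAvg γ Λ f) := by
  unfold kernelAvg
  exact Finset.measurable_fun_sum _ fun ξ _ =>
    ((hγ.measurable Λ).comp (measurable_updateFinset_config Λ ξ)).mul
      (hf.comp (measurable_updateFinset_config Λ ξ))

/-- The image measure `μ γ_Λ`. -/
noncomputable def kernelMeasure (γ : Finset L → (L → E) → ℝ) (Λ : Finset L)
    (μ : Measure (L → E)) : Measure (L → E) :=
  ∑ ξ : Λ → E, (μ.withDensity fun x =>
    ENNReal.ofReal (γ Λ (Function.updateFinset x Λ ξ))).map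
      fun x => Function.updateFinset x Λ ξ

theorem IsSpecification.kernelMeasure_apply (hγ : IsSpecification γ) (Λ : Finset L)
    (μ : Measure (L → E)) {s : Set (L → E)} (hs : MeasurableSet s) :
    kernelMeasure γ Λ μ s
      = ∫⁻ x, ENNReal.ofReal (kernelAvg γ Λ (s.indicator fun _ => 1) x) ∂μ := by
  have hd : ∀ ξ : Λ → E, Measurable fun x : L → E =>
      ENNReal.ofReal (γ Λ (Function.updateFinset x Λ ξ)) := fun ξ =>
    ((hγ.measurable Λ).comp (measurable_updateFinset_config Λ ξ)).ennreal_ofReal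
  have hs' : ∀ ξ : Λ → E, MeasurableSet ((fun x : L → E => Function.updateFinset x Λ ξ) ⁻¹' s) :=
    fun ξ => measurable_updateFinset_config Λ ξ hs
  simp only [kernelMeasure, Measure.finsetSum_apply, kernelAvg]
  have : ∀ x, ENNReal.ofReal (∑ ξ : Λ → E, γ Λ (Function.updateFinset x Λ ξ) *
      s.indicator (fun _ => (1 : ℝ)) (Function.updateFinset x Λ ξ))
      = ∑ ξ : Λ → E, ((fun x : L → E => Function.updateFinset x Λ ξ) ⁻¹' s).indicator
        (fun x => ENNReal.ofReal (γ Λ (Function.updateFinset x Λ ξ))) x := by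
    intro x
    rw [ENNReal.ofReal_sum_of_nonneg fun ξ _ => mul_nonneg (hγ.nonneg _ _)
      (Set.indicator_nonneg (fun _ _ => zero_le_one) _)]
    refine Finset.sum_congr rfl fun ξ _ => ?_
    by_cases hx : Function.updateFinset x Λ ξ ∈ s <;> simp [Set.indicator, hx]
  simp only [this]
  rw [lintegral_finsetSum _ fun ξ _ => (hd ξ).indicator (hs' ξ)]
  refine Finset.sum_congr rfl fun ξ _ => ?_
  rw [Measure.map_apply (measurable_updateFinset_config Λ ξ) hs, withDensity_apply _ (hs' ξ),
    lintegral_indicator (hs' ξ)]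

theorem IsSpecification.kernelAvg_indicator_mem (hγ : IsSpecification γ) (Λ : Finset L)
    (s : Set (L → E)) (x : L → E) :
    kernelAvg γ Λ (s.indicator fun _ => 1) x ∈ Set.Icc (0 : ℝ) 1 := by
  constructor
  · exact Finset.sum_nonneg fun ξ _ => mul_nonneg (hγ.nonneg _ _)
      (Set.indicator_nonneg (fun _ _ => zero_le_one) _)
  · refine (Finset.sum_le_sum fun ξ _ => mul_le_of_le_one_right (hγ.nonneg _ _) ?_).trans_eq
      (hγ.sum_eq_one Λ x)
    exact Set.indicator_le' (f := fun _ => (1 : ℝ)) (g := fun _ => (1 : ℝ))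
      (fun _ _ => le_rfl) (fun _ _ => zero_le_one) _

theorem IsSpecification.kernelMeasure_eq (hγ : IsSpecification γ) (Λ : Finset L)
    (μ : Measure (L → E)) [IsProbabilityMeasure μ]
    (h : ∀ s ∈ measurableCylinders fun _ : L => E,
      ∫ x, kernelAvg γ Λ (s.indicator fun _ => 1) x ∂μ = ∫ x, s.indicator (fun _ => (1 : ℝ)) x ∂μ) :
    kernelMeasure γ Λ μ = μ := by
  symm
  have key : ∀ s ∈ measurableCylinders fun _ : L => E, μ s = kernelMeasure γ Λ μ s := by
    intro s hs
    have hms : MeasurableSet s := MeasurableSet.of_mem_measurableCylinders hs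
    have hint : Integrable (kernelAvg γ Λ (s.indicator fun _ => 1)) μ := by
      refine Integrable.of_bound (hγ.measurable_kernelAvg Λ
        (measurable_const.indicator hms)).aestronglyMeasurable 1 (ae_of_all _ fun x => ?_)
      have := hγ.kernelAvg_indicator_mem Λ s x
      rw [Real.norm_eq_abs, abs_of_nonneg this.1]
      exact this.2
    rw [hγ.kernelMeasure_apply Λ μ hms, ← ofReal_integral_eq_lintegral_ofReal hint
      (ae_of_all _ fun x => (hγ.kernelAvg_indicator_mem Λ s x).1), h s hs,
      integral_indicator_const _ hms]
    simp
  refine ext_of_generate_finite _ generateFrom_measurableCylinders.symm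
    isPiSystem_measurableCylinders key (key _ ?_)
  exact univ_mem_measurableCylinders _

/-- The DLR equations hold for all integrable functions once they hold for indicators of
cylinders: these determine the image measure `μ γ_Λ`, which then equals `μ`. -/
theorem IsSpecification.isGibbs_of_cylinders (hγ : IsSpecification γ)
    (μ : ProbabilityMeasure (L → E))
    (h : ∀ Λ, ∀ s ∈ measurableCylinders fun _ : L => E,
      ∫ x, kernelAvg γ Λ (s.indicator fun _ => 1) x ∂(μ : Measure (L → E))
        = ∫ x, s.indicator (fun _ => (1 : ℝ)) x ∂(μ : Measure (L → E))) :
    IsGibbs γ μ := by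
  intro Λ f hf
  have hm := hγ.kernelMeasure_eq Λ μ (h Λ)
  have hT := measurable_updateFinset_config (E := E) Λ
  have hd : ∀ ξ : Λ → E, Measurable fun x : L → E =>
      (γ Λ (Function.updateFinset x Λ ξ)).toNNReal := fun ξ =>
    ((hγ.measurable Λ).comp (hT ξ)).real_toNNReal
  have hf' : ∀ ξ ∈ (Finset.univ : Finset (Λ → E)), Integrable f
      (((μ : Measure (L → E)).withDensity fun x =>
        ENNReal.ofReal (γ Λ (Function.updateFinset x Λ ξ))).map
          fun x => Function.updateFinset x Λ ξ) := by
    rw [← hm, kernelMeasure] at hf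
    exact integrable_finsetSum_measure.1 hf
  have hsmul : ∀ (ξ : Λ → E) (x : L → E),
      (γ Λ (Function.updateFinset x Λ ξ)).toNNReal • f (Function.updateFinset x Λ ξ)
        = γ Λ (Function.updateFinset x Λ ξ) * f (Function.updateFinset x Λ ξ) := by
    intro ξ x
    rw [NNReal.smul_def, Real.coe_toNNReal _ (hγ.nonneg _ _), smul_eq_mul]
  have hint : ∀ ξ ∈ (Finset.univ : Finset (Λ → E)), Integrable (fun x =>
      γ Λ (Function.updateFinset x Λ ξ) * f (Function.updateFinset x Λ ξ))
        (μ : Measure (L → E)) := by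
    intro ξ hξ
    have h1 := (hf' ξ hξ).comp_measurable (hT ξ)
    have h2 := (integrable_withDensity_iff_integrable_smul (hd ξ)).1 h1
    exact h2.congr (ae_of_all _ fun x => hsmul ξ x)
  refine ⟨integrable_finsetSum _ hint, ?_⟩
  unfold kernelAvg
  rw [integral_finsetSum _ hint]
  conv_rhs => rw [← hm, kernelMeasure]
  rw [integral_finsetSum_measure hf']
  refine Finset.sum_congr rfl fun ξ hξ => ?_
  rw [integral_map (hT ξ).aemeasurable (hf' ξ hξ).aestronglyMeasurable]
  refine Eq.trans ?_ (integral_withDensity_eq_integral_smul (hd ξ) _).symm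
  exact integral_congr_ae (ae_of_all _ fun x => (hsmul ξ x).symm)

/-- For a Gibbs measure, the single-site kernel is a version of the conditional probability of
the spin given all other spins. -/
theorem IsSpecification.condExp_eq (hγ : IsSpecification γ) [MeasurableSingletonClass E]
    {μ : ProbabilityMeasure (L → E)} (hμ : IsGibbs γ μ) (i : L) (a : E) :
    (μ : Measure (L → E))[Set.indicator {x : L → E | x i = a} (fun _ => (1 : ℝ)) |
        cylinderEvents (X := fun _ : L => E) ({i}ᶜ : Set L)]
      =ᵐ[(μ : Measure (L → E))] fun x => γ {i} (Function.update x i a) := by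
  classical
  -- `x ↦ update x i a` is measurable from the events off `i`; it fixes each such event.
  have hupd : ∀ b : E, Measurable[cylinderEvents (X := fun _ : L => E) ({i}ᶜ : Set L)]
      fun x : L → E => Function.update x i b := by
    intro b
    refine @measurable_pi_lambda _ _ _ (cylinderEvents ({i}ᶜ : Set L)) _ _ fun j => ?_
    by_cases hj : j = i
    · subst hj
      simp
    · simpa [Function.update_of_ne hj] using
        measurable_cylinderEvent_apply (X := fun _ : L => E) (Δ := {i}ᶜ) (i := j) hj
  have hinv : ∀ s : Set (L → E), MeasurableSet[cylinderEvents ({i}ᶜ : Set L)] s →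
      ∀ (x : L → E) (b : E), Function.update x i b ∈ s ↔ x ∈ s := by
    intro s hs x b
    have hle : cylinderEvents (X := fun _ : L => E) ({i}ᶜ : Set L)
        ≤ MeasurableSpace.comap (Set.domRestrict ({i}ᶜ : Set L)) MeasurableSpace.pi := by
      refine iSup₂_le fun j hj => ?_
      rintro _ ⟨t, ht, rfl⟩
      exact ⟨_, measurable_pi_apply (⟨j, hj⟩ : ({i}ᶜ : Set L)) ht, rfl⟩
    obtain ⟨t, -, rfl⟩ := hle s hs
    have : Set.domRestrict ({i}ᶜ : Set L) (Function.update x i b)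
        = Set.domRestrict ({i}ᶜ : Set L) x := by
      ext j
      exact Function.update_of_ne j.2 _ _
    simp only [Set.mem_preimage, this]
  have hA : MeasurableSet {x : L → E | x i = a} :=
    (measurable_pi_apply (X := fun _ : L => E) i) (measurableSet_singleton a)
  have hmeas : Measurable[cylinderEvents (X := fun _ : L => E) ({i}ᶜ : Set L)]
      fun x : L → E => γ {i} (Function.update x i a) := (hγ.measurable {i}).comp (hupd a)
  have havg : ∀ s : Set (L → E), MeasurableSet[cylinderEvents ({i}ᶜ : Set L)] s →
      kernelAvg γ {i} (s.indicator ({x : L → E | x i = a}.indicator fun _ => (1 : ℝ)))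
        = s.indicator fun x => γ {i} (Function.update x i a) := by
    intro s hs
    ext x
    rw [kernelAvg, sum_updateFinset_singleton i x fun y =>
      γ {i} y * s.indicator ({x : L → E | x i = a}.indicator fun _ => (1 : ℝ)) y]
    by_cases hx : x ∈ s
    · simp [Set.indicator, hinv s hs, hx]
    · simp [Set.indicator, hinv s hs, hx]
  have hgi : ∀ s : Set (L → E), MeasurableSet[cylinderEvents ({i}ᶜ : Set L)] s →
      Integrable (s.indicator fun x => γ {i} (Function.update x i a)) (μ : Measure (L → E)) ∧
      ∫ x in s, γ {i} (Function.update x i a) ∂(μ : Measure (L → E))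
        = ∫ x in s, {x : L → E | x i = a}.indicator (fun _ => (1 : ℝ)) x
          ∂(μ : Measure (L → E)) := by
    intro s hs
    have hs' : MeasurableSet s := cylinderEvents_le_pi s hs
    have h := hμ {i} _ (((integrable_const (1 : ℝ)).indicator hA).indicator hs')
    rw [havg s hs] at h
    rw [integral_indicator hs', integral_indicator hs'] at h
    exact h
  refine (ae_eq_condExp_of_forall_setIntegral_eq cylinderEvents_le_pi
    ((integrable_const (1 : ℝ)).indicator hA) (fun s hs _ => ?_)
    (fun s hs _ => (hgi s hs).2) hmeas.aestronglyMeasurable).symm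
  exact (integrable_indicator_iff (cylinderEvents_le_pi s hs)).1 (hgi s hs).1

end DLRExtension

/-! ### The DLR equations in the weak limit -/

section WeakLimit

variable {E : Type*}

theorem iterate_shift (n : ℕ) (x : ℤ → E) : shift^[n] x = fun i => x (i + n) := by
  induction n with
  | zero => simp
  | succ n ih =>
    rw [Function.iterate_succ_apply', ih]
    ext i
    simp only [shift]
    congr 1
    push_cast
    ring

theorem measurable_tailFrom [MeasurableSpace E] (p : ℕ) : Measurable (tailFrom (E := E) p) :=
  measurable_pi_lambda _ fun _ => measurable_pi_apply _

variable [Fintype E]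

/-- The half-line kernels, read from site `-p` on. -/
theorem kernelAvg_halfLineSpec_tailFrom (φ : (ℕ → E) → ℝ) (Λ : Finset ℕ) (p : ℕ)
    (g : (ℕ → E) → ℝ) (x : ℤ → E) :
    kernelAvg (halfLineSpec φ) Λ g (tailFrom p x)
      = kernelAvg (pastRatio φ (Λ.sup id + 1) p) (Λ.image fun j : ℕ => (j : ℤ) - p)
        (fun y => g (tailFrom p y)) x := by
  have he : Function.Injective fun j : ℕ => (j : ℤ) - p := fun a b h => by
    simpa using h
  have hr : ∀ y, pastRatio φ (Λ.sup id + 1) p (Λ.image fun j : ℕ => (j : ℤ) - p) y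
      = halfLineSpec φ Λ (tailFrom p y) := fun y => gibbsRatio_comp _ he
    (fun z => Real.exp (birkhoffSum halfShift φ (Λ.sup id + 1) z)) Λ y
  simp only [kernelAvg, hr]
  exact (sum_updateFinset_comp _ he Λ x fun z => halfLineSpec φ Λ z * g z).symm

/-- Under `μ_p`, the configuration read from site `-p` on has the law `ν`. -/
theorem map_tailFrom_shiftedMeasure [Nonempty E] [MeasurableSpace E] [MeasurableSingletonClass E]
    (ν : ProbabilityMeasure (ℕ → E)) (p : ℕ) :
    Measure.map (tailFrom p) (shiftedMeasure ν p : Measure (ℤ → E)) = ν := by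
  have h1 : (shiftedMeasure ν p : Measure (ℤ → E))
      = Measure.map (shift^[p]) (Measure.map glue
        ((uniformBernoulli (E := E) : Measure _).prod (ν : Measure (ℕ → E)))) := rfl
  rw [h1, Measure.map_map (measurable_tailFrom p) (measurable_shift.iterate p),
    Measure.map_map ((measurable_tailFrom p).comp (measurable_shift.iterate p)) measurable_glue]
  have h2 : (tailFrom p ∘ shift^[p]) ∘ glue (E := E) = Prod.snd := by
    ext q j
    simp [tailFrom, iterate_shift, glue]
  rw [h2, ← Measure.snd, Measure.snd_prod]

variable [TopologicalSpace E] {φ : (ℕ → E) → ℝ}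

theorem continuous_pastRatio (hφ : Continuous φ) (N p : ℕ) (Λ : Finset ℤ) :
    Continuous (pastRatio φ N p Λ) := by
  have hc := Real.continuous_exp.comp (continuous_pastEnergy hφ N p)
  exact hc.div (continuous_finsetSum _ fun ξ _ => hc.comp (continuous_updateFinset_left Λ ξ))
    fun x => (sum_weight_pos (fun y => Real.exp_pos (pastEnergy φ N p y)) Λ x).ne'

theorem continuous_kernelAvg {γ : Finset ℤ → (ℤ → E) → ℝ} {Λ : Finset ℤ} {f : (ℤ → E) → ℝ}
    (hγ : Continuous (γ Λ)) (hf : Continuous f) : Continuous (kernelAvg γ Λ f) :=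
  continuous_finsetSum _ fun ξ _ => (hγ.mul hf).comp (continuous_updateFinset_left Λ ξ)

theorem IsExtensible.tendstoUniformly_kernelAvg [Nonempty E] (hφ : IsExtensible φ)
    {Λ : Finset ℤ} {N : ℕ → ℕ} (hN : ∀ᶠ p : ℕ in atTop, ∀ i ∈ Λ, i + p < N p)
    {f : (ℤ → E) → ℝ} {C : ℝ} (hf : ∀ x, |f x| ≤ C) :
    TendstoUniformly (fun p => kernelAvg (pastRatio φ (N p) p) Λ f)
      (kernelAvg (wholeLineSpec φ) Λ f) atTop := by
  rw [Metric.tendstoUniformly_iff]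
  intro ε hε
  have hC : 0 ≤ C := (abs_nonneg _).trans (hf (Classical.arbitrary _))
  set K : ℝ := Fintype.card (Λ → E) * (C + 1) with hK
  have hcard : 0 < (Fintype.card (Λ → E) : ℝ) := by exact_mod_cast Fintype.card_pos
  have hKpos : 0 < K := by positivity
  filter_upwards [Metric.tendstoUniformly_iff.1 (hφ.tendstoUniformly_pastRatio hN) (ε / K)
    (by positivity)] with p hp x
  rw [Real.dist_eq, kernelAvg, kernelAvg, ← Finset.sum_sub_distrib]
  calc _ ≤ ∑ ξ : Λ → E, |wholeLineSpec φ Λ (Function.updateFinset x Λ ξ)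
            * f (Function.updateFinset x Λ ξ)
          - pastRatio φ (N p) p Λ (Function.updateFinset x Λ ξ)
            * f (Function.updateFinset x Λ ξ)| := Finset.abs_sum_le_sum_abs _ _
    _ < ∑ _ξ : Λ → E, ε / K * (C + 1) := by
        refine Finset.sum_lt_sum_of_nonempty Finset.univ_nonempty fun ξ _ => ?_
        rw [← sub_mul, abs_mul]
        have h1 := hp (Function.updateFinset x Λ ξ)
        rw [Real.dist_eq] at h1
        have h2 := hf (Function.updateFinset x Λ ξ)
        exact mul_lt_mul'' h1 (by linarith) (abs_nonneg _) (abs_nonneg _)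
    _ = ε := by
        rw [Finset.sum_const, Finset.card_univ, nsmul_eq_mul, hK]
        field_simp

variable [MeasurableSpace E] [BorelSpace E]

theorem integrable_of_continuous {f : (ℤ → E) → ℝ} (hf : Continuous f)
    (μ : ProbabilityMeasure (ℤ → E)) : Integrable f (μ : Measure (ℤ → E)) :=
  (BoundedContinuousFunction.mkOfCompact ⟨f, hf⟩).integrable _

theorem tendsto_integral_of_continuous {μs : ℕ → ProbabilityMeasure (ℤ → E)}
    {μ : ProbabilityMeasure (ℤ → E)} (hμ : Tendsto μs atTop (𝓝 μ)) {f : (ℤ → E) → ℝ}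
    (hf : Continuous f) :
    Tendsto (fun k => ∫ x, f x ∂(μs k : Measure (ℤ → E))) atTop
      (𝓝 (∫ x, f x ∂(μ : Measure (ℤ → E)))) :=
  ProbabilityMeasure.tendsto_iff_forall_integral_tendsto.1 hμ
    (BoundedContinuousFunction.mkOfCompact ⟨f, hf⟩)

/-- The energy range `max Λ + p + 1` of the half-line kernel in the volume `Λ + p`. -/
def tailRange (Λ : Finset ℤ) (p : ℕ) : ℕ :=
  (Λ.image fun i : ℤ => (i + p).toNat).sup id + 1

theorem add_lt_tailRange {Λ : Finset ℤ} {i : ℤ} (hi : i ∈ Λ) (p : ℕ) :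
    i + p < tailRange Λ p := by
  have := Finset.le_sup (f := id) (Finset.mem_image_of_mem (fun i : ℤ => (i + p).toNat) hi)
  simp only [tailRange, id] at this ⊢
  push_cast
  omega

variable [DiscreteTopology E]

/-- The DLR equation on the half-line, transported to `μ_p`. -/
theorem IsGibbs.integral_pastRatio [Nonempty E] {ν : ProbabilityMeasure (ℕ → E)}
    (hν : IsGibbs (halfLineSpec φ) ν) {p : ℕ} {Λ t : Finset ℤ}
    (hΛ : ∀ i ∈ Λ, 0 ≤ i + p) (ht : ∀ i ∈ t, 0 ≤ i + p) {f : (ℤ → E) → ℝ}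
    (hf : Continuous f) (hft : DependsOn f t) :
    ∫ x, kernelAvg (pastRatio φ (tailRange Λ p) p) Λ f x ∂(shiftedMeasure ν p : Measure (ℤ → E))
      = ∫ x, f x ∂(shiftedMeasure ν p : Measure (ℤ → E)) := by
  -- `f` only sees the sites from `-p` on, so it is a function `g` of the tail
  let g : (ℕ → E) → ℝ := fun z => f fun i => z (i + p).toNat
  have hgc : Continuous g := hf.comp (continuous_pi fun i => continuous_apply _)
  have hgf : ∀ x, g (tailFrom p x) = f x := by
    intro x
    refine hft fun i hi => ?_
    have := ht i hi
    simp only [tailFrom]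
    congr 1
    omega
  have himg : (Λ.image fun i : ℤ => (i + p).toNat).image (fun j : ℕ => (j : ℤ) - p) = Λ := by
    ext i
    simp only [Finset.mem_image, exists_exists_and_eq_and]
    constructor
    · rintro ⟨j, hj, rfl⟩
      rwa [Int.toNat_of_nonneg (hΛ j hj), add_sub_cancel_right]
    · intro hi
      exact ⟨i, hi, by rw [Int.toNat_of_nonneg (hΛ i hi), add_sub_cancel_right]⟩
  have hgi : Integrable g (ν : Measure (ℕ → E)) :=
    (BoundedContinuousFunction.mkOfCompact ⟨g, hgc⟩).integrable _
  have hk : ∀ x, kernelAvg (halfLineSpec φ) (Λ.image fun i : ℤ => (i + p).toNat) g (tailFrom p x)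
      = kernelAvg (pastRatio φ (tailRange Λ p) p) Λ f x := by
    intro x
    rw [kernelAvg_halfLineSpec_tailFrom, himg]
    simp only [hgf]
    rfl
  obtain ⟨h1, h2⟩ := hν (Λ.image fun i : ℤ => (i + p).toNat) g hgi
  rw [← map_tailFrom_shiftedMeasure ν p] at h1 h2 hgi
  rw [integral_map (measurable_tailFrom p).aemeasurable h1.aestronglyMeasurable,
    integral_map (measurable_tailFrom p).aemeasurable hgi.aestronglyMeasurable] at h2
  simpa only [hk, hgf] using h2

/-- The DLR equation for a local function survives in the weak limit: the finite-past kernels, for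
which it holds under `μ_p`, converge uniformly to a continuous kernel. -/
theorem IsGibbs.integral_wholeLineSpec [Nonempty E] (hφ : IsExtensible φ)
    {ν : ProbabilityMeasure (ℕ → E)} (hν : IsGibbs (halfLineSpec φ) ν)
    {n : ℕ → ℕ} (hn : Tendsto n atTop atTop) {μ : ProbabilityMeasure (ℤ → E)}
    (hμ : Tendsto (fun k => shiftedMeasure ν (n k)) atTop (𝓝 μ))
    (Λ t : Finset ℤ) {f : (ℤ → E) → ℝ} (hf : Continuous f) (hft : DependsOn f t) :
    ∫ x, kernelAvg (wholeLineSpec φ) Λ f x ∂(μ : Measure (ℤ → E))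
      = ∫ x, f x ∂(μ : Measure (ℤ → E)) := by
  obtain ⟨C, hC⟩ := isCompact_univ.exists_bound_of_continuousOn hf.continuousOn
  have hgc := continuous_kernelAvg (hφ.continuous_wholeLineSpec Λ) hf
  have h1 := tendsto_integral_of_continuous hμ hgc
  have h2 := tendsto_integral_of_continuous hμ hf
  have hu := Metric.tendstoUniformly_iff.1 (hφ.tendstoUniformly_kernelAvg (Λ := Λ)
    (N := tailRange Λ) (Eventually.of_forall fun p i hi => add_lt_tailRange hi p)
    fun x => hC x (Set.mem_univ x))
  have hdiff : Tendsto (fun k => ∫ x, kernelAvg (wholeLineSpec φ) Λ f x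
      ∂(shiftedMeasure ν (n k) : Measure (ℤ → E))
      - ∫ x, f x ∂(shiftedMeasure ν (n k) : Measure (ℤ → E))) atTop (𝓝 0) := by
    rw [Metric.tendsto_nhds]
    intro ε hε
    have hlarge : ∀ s : Finset ℤ, ∀ᶠ p : ℕ in atTop, ∀ i ∈ s, 0 ≤ i + (p : ℤ) := by
      intro s
      filter_upwards [eventually_ge_atTop (s.sup Int.natAbs)] with p hp i hi
      have := Finset.le_sup (f := Int.natAbs) hi
      omega
    filter_upwards [hn.eventually (hu (ε / 2) (by positivity)), hn.eventually (hlarge Λ),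
      hn.eventually (hlarge t)] with k hk hkΛ hkt
    rw [← hν.integral_pastRatio hkΛ hkt hf hft, ← integral_sub
      (integrable_of_continuous hgc _) (integrable_of_continuous
        (continuous_kernelAvg (continuous_pastRatio hφ.1 _ _ _) hf) _), dist_zero_right]
    have hb := norm_integral_le_of_norm_le_const
      (μ := (shiftedMeasure ν (n k) : Measure (ℤ → E)))
      (f := fun x => kernelAvg (wholeLineSpec φ) Λ f x
        - kernelAvg (pastRatio φ (tailRange Λ (n k)) (n k)) Λ f x)
      (ae_of_all _ fun x => (dist_eq_norm (kernelAvg (wholeLineSpec φ) Λ f x) _ ▸ hk x).le)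
    rw [probReal_univ, mul_one] at hb
    exact hb.trans_lt (by linarith)
  exact sub_eq_zero.1 (tendsto_nhds_unique (h1.sub h2) hdiff)

theorem IsGibbs.isGibbs_wholeLineSpec [Nonempty E] (hφ : IsExtensible φ)
    {ν : ProbabilityMeasure (ℕ → E)} (hν : IsGibbs (halfLineSpec φ) ν)
    {n : ℕ → ℕ} (hn : Tendsto n atTop atTop) {μ : ProbabilityMeasure (ℤ → E)}
    (hμ : Tendsto (fun k => shiftedMeasure ν (n k)) atTop (𝓝 μ)) :
    IsGibbs (wholeLineSpec φ) μ := by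
  refine hφ.isWholeLineSpec.isSpecification.isGibbs_of_cylinders μ fun Λ s hs => ?_
  obtain ⟨t, S, -, rfl⟩ := (mem_measurableCylinders s).1 hs
  refine hν.integral_wholeLineSpec hφ hn hμ Λ t ?_ ?_
  · -- `E^t` is discrete, so cylinders are clopen
    have hS : IsClopen (cylinder (α := fun _ : ℤ => E) t S) :=
      (isClopen_discrete S).preimage (f := t.restrict (π := fun _ => E))
        (continuous_pi fun i => continuous_apply (i : ℤ))
    exact continuous_const.indicator (by simp [hS.frontier_eq])
  · intro x y hxy
    have : t.restrict x = t.restrict y := by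
      ext i
      exact hxy i i.2
    have hiff : x ∈ cylinder t S ↔ y ∈ cylinder t S := by
      rw [mem_cylinder, mem_cylinder, this]
    by_cases hx : x ∈ cylinder t S
    · rw [Set.indicator_of_mem hx, Set.indicator_of_mem (hiff.1 hx)]
    · rw [Set.indicator_of_notMem hx, Set.indicator_of_notMem (mt hiff.2 hx)]

end WeakLimit

theorem theoremA {E : Type*} [Fintype E] [Nonempty E] [TopologicalSpace E] [DiscreteTopology E]
    [MeasurableSpace E] [BorelSpace E]
    (φ : (ℕ → E) → ℝ) (hφ : IsExtensible φ)
    (ν : ProbabilityMeasure (ℕ → E)) (hν : IsGibbs (halfLineSpec φ) ν)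
    (n : ℕ → ℕ) (hn : StrictMono n)
    (μ : ProbabilityMeasure (ℤ → E))
    (hμ : Tendsto (fun k => shiftedMeasure ν (n k)) atTop (𝓝 μ)) :
    ∃ γ : Finset ℤ → (ℤ → E) → ℝ,
      -- `γ` is the unique whole-line specification of `φ`
      (IsWholeLineSpec φ γ ∧ ∀ γ', IsWholeLineSpec φ γ' → γ' = γ) ∧
      -- `μ(x_0 = a | x_i, i ≠ 0) = γ_{0}(a | x_i, i ≠ 0)` almost surely
      (∀ a : E,
        (μ : Measure (ℤ → E))[Set.indicator {x : ℤ → E | x 0 = a} (fun _ => (1 : ℝ)) |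
            cylinderEvents (X := fun _ : ℤ => E) ({0}ᶜ : Set ℤ)]
          =ᵐ[(μ : Measure (ℤ → E))] fun x => γ {0} (Function.update x 0 a)) ∧
      -- the limit formula for the kernel at the origin
      (∀ x : ℤ → E, Tendsto (fun m : ℕ =>
          Real.exp (birkhoffSum halfShift φ (m + 1) (tailFrom m x)) /
            ∑ b : E, Real.exp
              (birkhoffSum halfShift φ (m + 1) (tailFrom m (Function.update x 0 b))))
        atTop (𝓝 (γ {0} x))) ∧
      -- `μ` is Gibbs for `γ`
      IsGibbs γ μ := by
  have hγ := hφ.isWholeLineSpec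
  have hG := hν.isGibbs_wholeLineSpec hφ hn.tendsto_atTop hμ
  refine ⟨wholeLineSpec φ, ⟨hγ, fun γ' hγ' => hγ'.eq hγ⟩,
    fun a => hγ.isSpecification.condExp_eq hG 0 a, fun x => ?_, hG⟩
  refine (hγ.singleSite 0 x).congr fun m => ?_
  have : ((0 : ℤ) + m + 1).toNat = m + 1 := by omega
  simp only [singleSiteRatio, this]
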